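/- Let $N,K\ge 1$ be integers, $\mu\in(-1,1)$, $P>0$ and $Q_{th}\ge 0$. Consider a user whose receiver (a fluid antenna) has $K$ ports and which is served by $N$ access points, each transmitting with power $P$. The complex channel gain from access point $m$ to port $k$ is $$g_k^{(m)}=\bigl(\sqrt{1-\mu^2}\,x_k^{(m)}+\mu x_0^{(m)}\bigr)+\mathrm j\bigl(\sqrt{1-\mu^2}\,y_k^{(m)}+\mu y_0^{(m)}\bigr),\qquad 1\le m\le N,\ 1\le k\le K,$$ where all the variables $x_0^{(m)},\dots,x_K^{(m)},y_0^{(m)},\dots,y_K^{(m)}$, $1\le m\le N$, are independent Gaussian random variables with mean $0$ and variance $1$. The power harvested at port $k$ is $Q_k=P\sum_{m=1}^N|g_k^{(m)}|^2$, and the user selects a port $k^*\in\arg\max_k Q_k$. Put $$Y_k=\sum_{m=1}^N\Bigl[\bigl(x_k^{(m)}+\tfrac{\mu}{\sqrt{1-\mu^2}}x_0^{(m)}\bigr)^2+\bigl(y_k^{(m)}+\tfrac{\mu}{\sqrt{1-\mu^2}}y_0^{(m)}\bigr)^2\Bigr].$$ Then the outage probability $\epsilon_{WET}=\Pr(Q_{k^*}<Q_{th})$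 of the wireless energy transfer satisfies $$\epsilon_{WET}=\Pr\Bigl(\max_{1\le k\le K}(1-\mu^2)P\,Y_k<Q_{th}\Bigr)=\int_0^\infty\frac{r^{N-1}e^{-r/2}}{2^N\Gamma(N)}\Bigl[1-Q_N\Bigl(\sqrt{\tfrac{\mu^2 r}{1-\mu^2}},\sqrt{\tfrac{Q_{th}}{P(1-\mu^2)}}\Bigr)\Bigr]^K\,dr,$$ where the integrand is integrable and $Q_N$ is the Marcum Q-function of order $N$: for $a>0$, $b\ge 0$, $$Q_N(a,b)=\int_b^\infty x\Bigl(\frac xa\Bigr)^{N-1}e^{-(x^2+a^2)/2}I_{N-1}(ax)\,dx,\qquad I_n(z)=\sum_{j\ge 0}\frac{(z/2)^{2j+n}}{j!\,(j+n)!},$$ and $Q_N(0,b)=\lim_{a\to 0^+}Q_N(a,b)=\int_b^\infty \frac{x^{2N-1}e^{-x^2/2}}{2^{N-1}(N-1)!}\,dx$. -/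

import Mathlib

open MeasureTheory ProbabilityTheory Set

noncomputable section

namespace FAMA

/-- The modified Bessel function of the first kind of integer order `n`,
`I_n(z) = ∑ (z/2)^(2j+n) / (j! (j+n)!)`. -/
def besselI (n : ℕ) (z : ℝ) : ℝ :=
  ∑' j : ℕ, (z / 2) ^ (2 * j + n) / ((j.factorial : ℝ) * ((j + n).factorial : ℝ))

/-- The generalized Marcum Q-function `Q_M(a, b)` of order `M ≥ 1`, for `a, b ≥ 0`:
`Q_M(a, b) = ∫_b^∞ x (x/a)^(M-1) exp(-(x²+a²)/2) I_{M-1}(a x) dx` if `a ≠ 0`. At `a = 0`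
the integrand is, as usual, read as its limit as `a → 0`, which is
`x^(2M-1) exp(-x²/2) / (2^(M-1) (M-1)!)`. -/
def marcumQ (M : ℕ) (a b : ℝ) : ℝ :=
  if a = 0 then
    ∫ x in Ioi b, x ^ (2 * M - 1) * Real.exp (-x ^ 2 / 2)
      / (2 ^ (M - 1) * ((M - 1).factorial : ℝ))
  else
    ∫ x in Ioi b, x * (x / a) ^ (M - 1) * Real.exp (-(x ^ 2 + a ^ 2) / 2)
      * besselI (M - 1) (a * x)

variable {Ω : Type*} {N K : ℕ}

/-- All the real variables `x_0, …, x_K` and `y_0, …, y_K` of all `N` access points, as a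
single family. Index `0` in `Fin (K + 1)` is the variable shared by the ports. -/
def allVars (x y : Fin N → Fin (K + 1) → Ω → ℝ) :
    (Fin N × Fin (K + 1)) ⊕ (Fin N × Fin (K + 1)) → Ω → ℝ
  | Sum.inl s => x s.1 s.2
  | Sum.inr s => y s.1 s.2

/-- The variables that generate the channel are mutually independent and standard normal. -/
structure IsChannel [MeasurableSpace Ω] (Pr : Measure Ω)
    (x y : Fin N → Fin (K + 1) → Ω → ℝ) : Prop where
  law : ∀ s, HasLaw (allVars x y s) (gaussianReal 0 1) Pr
  indep : iIndepFun (allVars x y) Pr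

/-- The complex channel gain between access point `m` and port `k` of the user. -/
def gain (μ : ℝ) (x y : Fin N → Fin (K + 1) → Ω → ℝ) (m : Fin N) (k : Fin K) (ω : Ω) : ℂ :=
  ((√(1 - μ ^ 2) * x m k.succ ω + μ * x m 0 ω : ℝ) : ℂ)
    + Complex.I * ((√(1 - μ ^ 2) * y m k.succ ω + μ * y m 0 ω : ℝ) : ℂ)

/-- The power harvested at port `k`, when access point `m` transmits with power `p m`. -/
def harvestedPower (μ : ℝ) (p : Fin N → ℝ) (x y : Fin N → Fin (K + 1) → Ω → ℝ)
    (k : Fin K) (ω : Ω) : ℝ :=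
  ∑ m, p m * ‖gain μ x y m k ω‖ ^ 2

/-- The normalized port power `Y_k`. -/
def normPower (μ : ℝ) (x y : Fin N → Fin (K + 1) → Ω → ℝ) (k : Fin K) (ω : Ω) : ℝ :=
  ∑ m, ((x m k.succ ω + μ / √(1 - μ ^ 2) * x m 0 ω) ^ 2
    + (y m k.succ ω + μ / √(1 - μ ^ 2) * y m 0 ω) ^ 2)

/-- `kstar` selects, for every outcome, a port that maximizes the harvested power. -/
def IsBestPort (μ : ℝ) (p : Fin N → ℝ) (x y : Fin N → Fin (K + 1) → Ω → ℝ)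
    (kstar : Ω → Fin K) : Prop :=
  ∀ ω k, harvestedPower μ p x y k ω ≤ harvestedPower μ p x y (kstar ω) ω

/-- The outage probability of the wireless energy transfer: the probability that the power
harvested at the selected port is lower than the threshold. -/
def wetOutage [MeasurableSpace Ω] (Pr : Measure Ω) (μ : ℝ) (p : Fin N → ℝ)
    (x y : Fin N → Fin (K + 1) → Ω → ℝ) (kstar : Ω → Fin K) (Qth : ℝ) : ℝ :=
  Pr.real {ω | harvestedPower μ p x y (kstar ω) ω < Qth}

end FAMA

end

noncomputable section

namespace FAMA

/-! The best port is in outage exactly when every port is, so the outage event says that all `Y_k`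
lie below `T = Qth / (P (1 - μ²))`. Put `c = μ / √(1 - μ²)` and fix the vector `u ∈ ℝ^(2N)` of
shared variables. The `Y_k` are then independent, each being the squared norm of a standard Gaussian
vector shifted by `c u`. Its law is noncentral chi-square with noncentrality `c² |u|²`, so the
conditional probability is a `K`-th power depending only on `|u|²`. Since `|u|²` is central
chi-square with `2N` degrees of freedom, Fubini gives the integral
(`prod_pi_gaussianReal_forall_lt`).

The noncentral law is taken as a Poisson mixture of Gamma laws. Characteristic functions identify it
with the Gaussian one (`map_sum_sq_add_pi_gaussianReal`). Its density is the Bessel series, so its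
tail is the Marcum function (`marcumQ_eq_noncentralChiSq_real`). -/

/-! ### Characteristic functions of Gamma laws. -/

open Complex in
theorem integral_pow_mul_cexp_Ioi {z : ℂ} (hz : 0 < z.re) (n : ℕ) :
    IntegrableOn (fun x : ℝ => (x : ℂ) ^ n * cexp (-z * x)) (Ioi 0) ∧
      ∫ x in Ioi (0 : ℝ), (x : ℂ) ^ n * cexp (-z * x) = n.factorial / z ^ (n + 1) := by
  have hz0 : z ≠ 0 := by rintro rfl; simp at hz
  have hnorm : ∀ (n : ℕ) (x : ℝ), 0 < x →
      ‖(x : ℂ) ^ n * cexp (-z * x)‖ = x ^ n * Real.exp (-z.re * x) := by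
    intro n x hx
    simp [Complex.norm_exp, abs_of_pos hx]
  have hint : ∀ n : ℕ, IntegrableOn (fun x : ℝ => (x : ℂ) ^ n * cexp (-z * x)) (Ioi 0) := by
    intro n
    have h := integrableOn_rpow_mul_exp_neg_mul_rpow (s := n) (p := 1) (b := z.re)
      (by have : (0 : ℝ) ≤ n := n.cast_nonneg
          linarith) one_pos hz
    refine Integrable.mono h (by fun_prop) ?_
    refine (ae_restrict_iff' measurableSet_Ioi).2 (ae_of_all _ fun x hx => ?_)
    rw [hnorm n x hx]
    simp [abs_of_pos (show (0 : ℝ) < x from hx)]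
  refine ⟨hint n, ?_⟩
  induction n with
  | zero =>
    have := integral_exp_mul_complex_Ioi (a := -z) (by simpa using hz) 0
    simpa using this
  | succ n ih =>
    -- Integrating this derivative gives `z I(n+1) = (n+1) I(n)`: both boundary terms vanish.
    have hderiv : ∀ x ∈ Ici (0 : ℝ), HasDerivAt (fun x : ℝ => (x : ℂ) ^ (n + 1) * cexp (-z * x))
        ((n + 1 : ℂ) * ((x : ℂ) ^ n * cexp (-z * x))
          - z * ((x : ℂ) ^ (n + 1) * cexp (-z * x))) x := by
      intro x _
      have h1 : HasDerivAt (fun x : ℂ => x ^ (n + 1) * cexp (-z * x))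
          ((n + 1 : ℂ) * ((x : ℂ) ^ n * cexp (-z * x))
          - z * ((x : ℂ) ^ (n + 1) * cexp (-z * x))) (x : ℂ) := by
        have := (hasDerivAt_pow (n + 1) (x : ℂ)).mul (((hasDerivAt_id (x : ℂ)).const_mul (-z)).cexp)
        convert! this using 1
        simp; ring
      exact h1.comp_ofReal
    have hlim : Filter.Tendsto (fun x : ℝ => (x : ℂ) ^ (n + 1) * cexp (-z * x)) Filter.atTop
        (nhds 0) := by
      rw [tendsto_zero_iff_norm_tendsto_zero]
      have := Real.tendsto_pow_mul_exp_neg_atTop_nhds_zero (n + 1)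
      have h2 : Filter.Tendsto (fun x : ℝ => (z.re ^ (n + 1))⁻¹ *
          ((z.re * x) ^ (n + 1) * Real.exp (-(z.re * x)))) Filter.atTop (nhds 0) := by
        simpa using (this.comp (Filter.tendsto_id.const_mul_atTop hz)).const_mul
          ((z.re ^ (n + 1))⁻¹)
      refine h2.congr' ?_
      filter_upwards [Filter.eventually_gt_atTop 0] with x hx
      rw [hnorm _ x hx, mul_pow, neg_mul]
      field_simp
    have h := integral_Ioi_of_hasDerivAt_of_tendsto' hderiv
      (((hint n).const_mul _).sub ((hint (n + 1)).const_mul _)) hlim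
    rw [integral_sub ((hint n).const_mul _) ((hint (n + 1)).const_mul _),
      integral_const_mul, integral_const_mul, ih] at h
    have h' : z * ∫ x in Ioi (0 : ℝ), (x : ℂ) ^ (n + 1) * cexp (-z * x)
        = (n + 1 : ℂ) * (n.factorial / z ^ (n + 1)) := by
      rw [Complex.ofReal_zero, zero_pow n.succ_ne_zero, zero_mul, sub_zero] at h
      linear_combination -h
    rw [Nat.factorial_succ]
    push_cast
    apply mul_left_cancel₀ hz0
    rw [h']
    field_simp
    ring

theorem one_sub_ne_zero (t : ℝ) : 1 - 2 * (t * Complex.I) ≠ 0 := by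
  intro h
  simpa using congrArg Complex.re h

/-- The density of the chi-square law with `2 (m + 1)` degrees of freedom, on `[0, ∞)`. -/
def chiSqDensity (m : ℕ) (x : ℝ) : ℝ :=
  x ^ m * Real.exp (-x / 2) / (2 ^ (m + 1) * m.factorial)

theorem gammaPDFReal_half (m : ℕ) {x : ℝ} (hx : 0 ≤ x) :
    gammaPDFReal (m + 1) (1 / 2) x = chiSqDensity m x := by
  rw [gammaPDFReal, if_pos hx, chiSqDensity, Real.Gamma_nat_eq_factorial, add_sub_cancel_right,
    Real.rpow_natCast, show (m : ℝ) + 1 = ((m + 1 : ℕ) : ℝ) by push_cast; rfl, Real.rpow_natCast]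
  rw [show -(1 / 2 * x) = -x / 2 by ring]
  rw [one_div, inv_pow]
  field_simp

theorem charFun_gammaMeasure_half (m : ℕ) (t : ℝ) :
    charFun (gammaMeasure (m + 1) (1 / 2)) t = ((1 - 2 * (t * Complex.I)) ^ (m + 1))⁻¹ := by
  have hmeas : Measurable (gammaPDF (m + 1) (1 / 2)) :=
    (measurable_gammaPDFReal _ _).ennreal_ofReal
  rw [charFun_apply_real, gammaMeasure, integral_withDensity_eq_integral_toReal_smul
    hmeas (ae_of_all _ fun _ => ENNReal.ofReal_lt_top)]
  have hnn : ∀ x, 0 ≤ gammaPDFReal (m + 1) (1 / 2) x :=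
    gammaPDFReal_nonneg (by positivity) (by positivity)
  have h0 : ∀ x ∉ Ici (0 : ℝ), (gammaPDF (m + 1) (1 / 2) x).toReal •
      Complex.exp (t * x * Complex.I) = 0 := by
    intro x hx
    rw [gammaPDF_of_neg (by simpa using hx)]
    simp
  rw [← setIntegral_eq_integral_of_forall_compl_eq_zero h0, integral_Ici_eq_integral_Ioi]
  have hre : 0 < ((1 - 2 * (t * Complex.I)) / 2 : ℂ).re := by simp
  have h := (integral_pow_mul_cexp_Ioi hre m).2
  calc _ = ∫ x in Ioi (0 : ℝ), ((2 ^ (m + 1) * m.factorial : ℂ))⁻¹ * ((x : ℂ) ^ m *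
        Complex.exp (-((1 - 2 * (t * Complex.I)) / 2) * x)) := by
        refine setIntegral_congr_fun measurableSet_Ioi fun x hx => ?_
        simp only [gammaPDF]
        rw [ENNReal.toReal_ofReal (hnn x), gammaPDFReal_half m (le_of_lt hx), chiSqDensity,
          Complex.real_smul]
        push_cast
        rw [show -((1 - 2 * (t * Complex.I)) / 2) * x = (-x / 2 : ℂ) + t * x * Complex.I by ring,
          Complex.exp_add]
        ring
    _ = _ := by
        rw [integral_const_mul, h, div_pow]
        have := one_sub_ne_zero t
        have h3 : (m.factorial : ℂ) ≠ 0 := by exact_mod_cast m.factorial_ne_zero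
        field_simp

/-! ### The noncentral chi-square law and shifted Gaussian vectors. -/

/-- The weights of the Poisson law with parameter `l / 2`. -/
def poissonWeight (l : ℝ) (j : ℕ) : ℝ := Real.exp (-l / 2) * ((l / 2) ^ j / j.factorial)

theorem poissonWeight_nonneg {l : ℝ} (hl : 0 ≤ l) (j : ℕ) : 0 ≤ poissonWeight l j := by
  unfold poissonWeight; positivity

theorem hasSum_poissonWeight (l : ℝ) : HasSum (poissonWeight l) 1 := by
  have h := (NormedSpace.expSeries_div_hasSum_exp (l / 2)).mul_left (Real.exp (-l / 2))
  rw [← Real.exp_eq_exp_ℝ, ← Real.exp_add] at h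
  rwa [show -l / 2 + l / 2 = 0 by ring, Real.exp_zero] at h

/-- The noncentral chi-square law with `2 (n + 1)` degrees of freedom and noncentrality `l`,
as a Poisson mixture of central ones. -/
def noncentralChiSq (n : ℕ) (l : ℝ) : Measure ℝ :=
  Measure.sum fun j : ℕ =>
    ENNReal.ofReal (poissonWeight l j) • gammaMeasure ((n + j : ℕ) + 1) (1 / 2)

theorem isProbabilityMeasure_gamma_half (m : ℕ) :
    IsProbabilityMeasure (gammaMeasure ((m : ℕ) + 1) (1 / 2)) :=
  isProbabilityMeasure_gammaMeasure (by positivity) (by positivity)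

theorem isProbabilityMeasure_noncentralChiSq (n : ℕ) {l : ℝ} (hl : 0 ≤ l) :
    IsProbabilityMeasure (noncentralChiSq n l) where
  measure_univ := by
    have := isProbabilityMeasure_gamma_half
    rw [noncentralChiSq, Measure.sum_apply _ MeasurableSet.univ]
    simp only [Measure.smul_apply, measure_univ, smul_eq_mul, mul_one]
    rw [← ENNReal.ofReal_tsum_of_nonneg (poissonWeight_nonneg hl) (hasSum_poissonWeight l).summable,
      (hasSum_poissonWeight l).tsum_eq, ENNReal.ofReal_one]

/-- With `z = 1 - 2it`, the Poisson average of `z^-(n+1+j)` is `z^-(n+1) exp(-l/2 + l/(2z))`, and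
`1/z - 1 = 2it/z`. -/
theorem charFun_noncentralChiSq (n : ℕ) {l : ℝ} (hl : 0 ≤ l) (t : ℝ) :
    charFun (noncentralChiSq n l) t = ((1 - 2 * (t * Complex.I)) ^ (n + 1))⁻¹ *
      Complex.exp (l * (t * Complex.I) / (1 - 2 * (t * Complex.I))) := by
  have := isProbabilityMeasure_noncentralChiSq n hl
  have hz := one_sub_ne_zero t
  set z : ℂ := 1 - 2 * (t * Complex.I) with hzdef
  have hint : Integrable (fun x : ℝ => Complex.exp (t * x * Complex.I)) (noncentralChiSq n l) := by
    refine Integrable.of_bound (by fun_prop) 1 (ae_of_all _ fun x => ?_)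
    rw [← Complex.ofReal_mul, Complex.norm_exp_ofReal_mul_I]
  have h1 := hasSum_integral_measure hint
  have h2 : HasSum (fun j : ℕ => (z ^ (n + 1))⁻¹ * Complex.exp (-l / 2) *
      ((l / (2 * z)) ^ j / j.factorial)) ((z ^ (n + 1))⁻¹ * Complex.exp (-l / 2) *
      Complex.exp (l / (2 * z))) := by
    have h := NormedSpace.expSeries_div_hasSum_exp (l / (2 * z) : ℂ)
    rw [← Complex.exp_eq_exp_ℂ] at h
    exact h.mul_left _
  have h3 : (∫ x : ℝ, Complex.exp (t * x * Complex.I) ∂(noncentralChiSq n l)) =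
      (z ^ (n + 1))⁻¹ * Complex.exp (-l / 2) * Complex.exp (l / (2 * z)) := by
    refine h1.unique (h2.congr_fun ?_)
    intro j
    rw [integral_smul_measure, ← charFun_apply_real, charFun_gammaMeasure_half,
      ENNReal.toReal_ofReal (poissonWeight_nonneg hl j), Complex.real_smul, poissonWeight, ← hzdef]
    push_cast
    rw [div_pow, div_pow, mul_pow, add_right_comm, pow_add z (n + 1) j]
    field_simp
  rw [charFun_apply_real, h3, mul_assoc, ← Complex.exp_add]
  congr 2
  field_simp
  rw [hzdef]
  ring

/-- Only `A²` matters, because the dimension will be even; no branch of the square root has to be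
tracked. `A` is the same for all shifts `w`. -/
theorem integral_cexp_sq_gaussianReal (t : ℝ) :
    ∃ A : ℂ, A ^ 2 = (1 - 2 * (t * Complex.I))⁻¹ ∧ ∀ w : ℝ,
      ∫ x : ℝ, Complex.exp (t * ((x + w) ^ 2 : ℝ) * Complex.I) ∂(gaussianReal 0 1)
        = A * Complex.exp (w ^ 2 * (t * Complex.I) / (1 - 2 * (t * Complex.I))) := by
  have hz := one_sub_ne_zero t
  set z : ℂ := 1 - 2 * (t * Complex.I) with hzdef
  have hre : (-z / 2).re < 0 := by norm_num [hzdef]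
  refine ⟨(√(2 * Real.pi))⁻¹ * (Real.pi / (-(-z / 2))) ^ (1 / 2 : ℂ), ?_, fun w => ?_⟩
  · rw [mul_pow, ← Complex.cpow_nat_mul, Complex.ofReal_inv, inv_pow, ← Complex.ofReal_pow,
      Real.sq_sqrt (by positivity), show ((2 : ℕ) : ℂ) * (1 / 2) = 1 by norm_num,
      Complex.cpow_one]
    have : (Real.pi : ℂ) ≠ 0 := by simp [Real.pi_ne_zero]
    push_cast
    field_simp
  · rw [integral_gaussianReal_eq_integral_smul one_ne_zero]
    calc _ = ∫ x : ℝ, ((√(2 * Real.pi))⁻¹ : ℂ) * Complex.exp (-z / 2 * x ^ 2 +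
          2 * t * Complex.I * w * x + t * Complex.I * w ^ 2) := by
          refine integral_congr_ae (ae_of_all _ fun x => ?_)
          simp only [gaussianPDFReal, Complex.real_smul]
          push_cast
          rw [mul_assoc, ← Complex.exp_add]
          simp only [mul_one]
          congr 2
          rw [hzdef]
          ring
      _ = _ := by
          rw [integral_const_mul, integral_cexp_quadratic hre, ← mul_assoc, Complex.ofReal_inv]
          congr 2
          field_simp
          rw [hzdef]
          ring_nf

/-- The squared norm of a standard Gaussian vector of even dimension, shifted by `w`, has a
noncentral chi-square law. -/
theorem map_sum_sq_add_pi_gaussianReal {ι : Type*} [Fintype ι] (n : ℕ)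
    (hι : Fintype.card ι = 2 * (n + 1)) (w : ι → ℝ) :
    (Measure.pi fun _ : ι => gaussianReal 0 1).map (fun z => ∑ i, (z i + w i) ^ 2)
      = noncentralChiSq n (∑ i, w i ^ 2) := by
  have hl : 0 ≤ ∑ i, w i ^ 2 := Finset.sum_nonneg fun i _ => sq_nonneg _
  have := isProbabilityMeasure_noncentralChiSq n hl
  have hm : Measurable fun z : ι → ℝ => ∑ i, (z i + w i) ^ 2 := by fun_prop
  have := Measure.isProbabilityMeasure_map
    (μ := Measure.pi fun _ : ι => gaussianReal 0 1) hm.aemeasurable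
  refine Measure.ext_of_charFun (funext fun t => ?_)
  obtain ⟨A, hA, h⟩ := integral_cexp_sq_gaussianReal t
  rw [charFun_noncentralChiSq n hl, charFun_apply_real,
    integral_map hm.aemeasurable (by fun_prop)]
  calc _ = ∫ z : ι → ℝ, ∏ i, Complex.exp (t * ((z i + w i) ^ 2 : ℝ) * Complex.I)
        ∂(Measure.pi fun _ : ι => gaussianReal 0 1) := by
        refine integral_congr_ae (ae_of_all _ fun z => ?_)
        simp only
        rw [← Complex.exp_sum, ← Finset.sum_mul, ← Finset.mul_sum]
        push_cast
        rfl
    _ = _ := by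
        rw [integral_fintype_prod_eq_prod (𝕜 := ℂ)
          (fun i (x : ℝ) => Complex.exp (t * ((x + w i) ^ 2 : ℝ) * Complex.I))]
        simp only [h]
        rw [Finset.prod_mul_distrib, Finset.prod_const, Finset.card_univ, hι, pow_mul, hA,
          inv_pow, ← Complex.exp_sum, ← Finset.sum_div, ← Finset.sum_mul]
        push_cast
        rfl

/-! ### Densities and the Marcum Q-function. -/

theorem chiSqDensity_nonneg (m : ℕ) {x : ℝ} (hx : 0 ≤ x) : 0 ≤ chiSqDensity m x := by
  unfold chiSqDensity; positivity

/-- The density of the noncentral chi-square law, on `[0, ∞)`. -/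
def noncentralDensity (n : ℕ) (l x : ℝ) : ℝ :=
  ∑' j : ℕ, poissonWeight l j * chiSqDensity (n + j) x

theorem summable_noncentralDensity (n : ℕ) {l x : ℝ} (hl : 0 ≤ l) (hx : 0 ≤ x) :
    Summable fun j : ℕ => poissonWeight l j * chiSqDensity (n + j) x := by
  have h := (Real.summable_pow_div_factorial (l / 2 * x)).mul_left
    (Real.exp (-l / 2) * x ^ n * Real.exp (-x / 2))
  refine Summable.of_nonneg_of_le (fun j => mul_nonneg (poissonWeight_nonneg hl j)
    (chiSqDensity_nonneg _ hx)) (fun j => ?_) h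
  have h1 : (1 : ℝ) ≤ 2 ^ (n + j + 1) * (n + j).factorial := by
    exact_mod_cast Nat.one_le_iff_ne_zero.2 (by positivity)
  have h2 : chiSqDensity (n + j) x ≤ x ^ (n + j) * Real.exp (-x / 2) :=
    div_le_self (by positivity) h1
  calc _ ≤ poissonWeight l j * (x ^ (n + j) * Real.exp (-x / 2)) :=
        mul_le_mul_of_nonneg_left h2 (poissonWeight_nonneg hl j)
    _ = _ := by
        rw [poissonWeight, pow_add, mul_pow]; ring

theorem noncentralDensity_nonneg (n : ℕ) {l x : ℝ} (hl : 0 ≤ l) (hx : 0 ≤ x) :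
    0 ≤ noncentralDensity n l x :=
  tsum_nonneg fun j => mul_nonneg (poissonWeight_nonneg hl j) (chiSqDensity_nonneg _ hx)

theorem ofReal_noncentralDensity (n : ℕ) {l x : ℝ} (hl : 0 ≤ l) (hx : 0 ≤ x) :
    ENNReal.ofReal (noncentralDensity n l x)
      = ∑' j : ℕ, ENNReal.ofReal (poissonWeight l j) * gammaPDF ((n + j : ℕ) + 1) (1 / 2) x := by
  rw [noncentralDensity, ENNReal.ofReal_tsum_of_nonneg
    (fun j => mul_nonneg (poissonWeight_nonneg hl j) (chiSqDensity_nonneg _ hx))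
    (summable_noncentralDensity n hl hx)]
  refine tsum_congr fun j => ?_
  rw [ENNReal.ofReal_mul (poissonWeight_nonneg hl j), gammaPDF, gammaPDFReal_half _ hx]

theorem measurable_gammaPDF_half (m : ℕ) : Measurable (gammaPDF ((m : ℕ) + 1) (1 / 2)) :=
  (measurable_gammaPDFReal _ _).ennreal_ofReal

theorem noncentralChiSq_eq_withDensity (n : ℕ) (l : ℝ) :
    noncentralChiSq n l = volume.withDensity (fun x => ∑' j : ℕ,
      ENNReal.ofReal (poissonWeight l j) * gammaPDF ((n + j : ℕ) + 1) (1 / 2) x) := by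
  have hm := measurable_gammaPDF_half
  have h : (fun x => ∑' j : ℕ, ENNReal.ofReal (poissonWeight l j) *
      gammaPDF ((n + j : ℕ) + 1) (1 / 2) x) = ∑' j : ℕ, ENNReal.ofReal (poissonWeight l j) •
      gammaPDF ((n + j : ℕ) + 1) (1 / 2) := by
    ext x
    rw [tsum_apply (Pi.summable.2 fun _ => ENNReal.summable)]
    rfl
  rw [h, withDensity_tsum fun j => (hm _).const_smul _]
  simp only [withDensity_smul _ (hm _)]
  rfl

theorem noncentralChiSq_Iio_zero (n : ℕ) (l : ℝ) : noncentralChiSq n l (Iio 0) = 0 := by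
  rw [noncentralChiSq_eq_withDensity, withDensity_apply _ measurableSet_Iio,
    setLIntegral_congr_fun (g := fun _ => 0) measurableSet_Iio, lintegral_zero]
  intro x hx
  simp [gammaPDF_of_neg (show x < 0 from hx)]

/-- The restriction to `[0, ∞)` is needed because `chiSqDensity` is not cut off at negative
arguments, unlike `gammaPDF`. -/
theorem restrict_noncentralChiSq (n : ℕ) {l : ℝ} (hl : 0 ≤ l) {S : Set ℝ}
    (hS : MeasurableSet S) (h0 : S ⊆ Ici 0) :
    (noncentralChiSq n l).restrict S
      = (volume.restrict S).withDensity fun x => ENNReal.ofReal (noncentralDensity n l x) := by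
  rw [noncentralChiSq_eq_withDensity, restrict_withDensity hS]
  refine withDensity_congr_ae ((ae_restrict_iff' hS).2 (ae_of_all _ fun x hx => ?_))
  exact (ofReal_noncentralDensity n hl (h0 hx)).symm

theorem aestronglyMeasurable_noncentralDensity (n : ℕ) {l : ℝ} (hl : 0 ≤ l) {S : Set ℝ}
    (hS : MeasurableSet S) (h0 : S ⊆ Ici 0) :
    AEStronglyMeasurable (noncentralDensity n l) (volume.restrict S) := by
  have hm : Measurable (fun x => ∑' j : ℕ,
      ENNReal.ofReal (poissonWeight l j) * gammaPDF ((n + j : ℕ) + 1) (1 / 2) x) :=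
    Measurable.tsum fun j => (measurable_gammaPDF_half _).const_mul _
  refine hm.ennreal_toReal.aestronglyMeasurable.congr
    ((ae_restrict_iff' hS).2 (ae_of_all _ fun x hx => ?_))
  simp only
  rw [← ofReal_noncentralDensity n hl (h0 hx),
    ENNReal.toReal_ofReal (noncentralDensity_nonneg n hl (h0 hx))]

theorem noncentralChiSq_real_eq_integral (n : ℕ) {l : ℝ} (hl : 0 ≤ l) {S : Set ℝ}
    (hS : MeasurableSet S) (h0 : S ⊆ Ici 0) :
    (noncentralChiSq n l).real S = ∫ x in S, noncentralDensity n l x := by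
  rw [integral_eq_lintegral_of_nonneg_ae
    ((ae_restrict_iff' hS).2 (ae_of_all _ fun x hx => noncentralDensity_nonneg n hl (h0 hx)))
    (aestronglyMeasurable_noncentralDensity n hl hS h0), Measure.real,
    ← Measure.restrict_apply_univ, restrict_noncentralChiSq n hl hS h0,
    withDensity_apply _ MeasurableSet.univ, Measure.restrict_univ]

theorem noncentralDensity_zero (n : ℕ) (x : ℝ) : noncentralDensity n 0 x = chiSqDensity n x := by
  rw [noncentralDensity, tsum_eq_single 0 (fun j hj => by simp [poissonWeight, hj])]
  simp [poissonWeight]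

/-- The Bessel series and the Poisson mixture agree term by term; `2 * x` is the Jacobian of `x ↦
x²`. -/
theorem marcumQ_integrand_eq (n : ℕ) {a x : ℝ} (ha : a ≠ 0) :
    x * (x / a) ^ n * Real.exp (-(x ^ 2 + a ^ 2) / 2) * besselI n (a * x)
      = 2 * x * noncentralDensity n (a ^ 2) (x ^ 2) := by
  rw [besselI, noncentralDensity, ← tsum_mul_left, ← tsum_mul_left]
  refine tsum_congr fun j => ?_
  rw [poissonWeight, chiSqDensity, show -(x ^ 2 + a ^ 2) / 2 = -a ^ 2 / 2 + -x ^ 2 / 2 by ring,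
    Real.exp_add, add_comm n j]
  rw [div_pow, div_pow, div_pow, mul_pow, ← pow_mul, ← pow_mul, pow_add a, mul_add 2 j n,
    pow_add 2 (2 * j) n]
  field_simp
  ring

theorem marcumQ_eq_noncentralChiSq_real (n : ℕ) {l T : ℝ} (hl : 0 ≤ l) (hT : 0 ≤ T) :
    marcumQ (n + 1) (√l) (√T) = (noncentralChiSq n l).real (Ioi T) := by
  rw [noncentralChiSq_real_eq_integral n hl measurableSet_Ioi
    (fun x hx => hT.trans (le_of_lt hx)),
    ← integral_comp_rpow_Ioi_of_pos' (g := noncentralDensity n l) two_pos hT,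
    show T ^ (2 : ℝ)⁻¹ = √T by rw [Real.sqrt_eq_rpow, one_div], marcumQ]
  simp only [add_tsub_cancel_right, smul_eq_mul]
  have h1 : ∀ x : ℝ, 2 * x ^ ((2 : ℝ) - 1) * noncentralDensity n l (x ^ (2 : ℝ))
      = 2 * x * noncentralDensity n l (x ^ 2) := by
    intro x
    rw [show (2 : ℝ) - 1 = 1 by norm_num, Real.rpow_one, Real.rpow_two]
  simp only [h1]
  split_ifs with h
  -- At noncentrality zero only the Poisson term `j = 0` survives, which is the limiting integrand
  -- in `marcumQ`.
  · obtain rfl : l = 0 := (Real.sqrt_eq_zero hl).1 h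
    refine integral_congr_ae (ae_of_all _ fun x => ?_)
    simp only
    rw [noncentralDensity_zero, chiSqDensity, show 2 * (n + 1) - 1 = 2 * n + 1 by omega, pow_succ,
      pow_mul, pow_succ 2 n]
    field_simp
  · refine integral_congr_ae (ae_of_all _ fun x => ?_)
    simp only
    rw [marcumQ_integrand_eq n h, Real.sq_sqrt hl]

instance nullSingletonClass_noncentralChiSq (n : ℕ) (l : ℝ) :
    NullSingletonClass (noncentralChiSq n l) := by
  rw [noncentralChiSq_eq_withDensity]
  infer_instance

theorem one_sub_marcumQ (n : ℕ) {l T : ℝ} (hl : 0 ≤ l) (hT : 0 ≤ T) :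
    1 - marcumQ (n + 1) (√l) (√T) = (noncentralChiSq n l).real (Iio T) := by
  have := isProbabilityMeasure_noncentralChiSq n hl
  rw [marcumQ_eq_noncentralChiSq_real n hl hT, ← compl_Iic, probReal_compl_eq_one_sub
    measurableSet_Iic, sub_sub_cancel]
  exact (measureReal_congr Iio_ae_eq_Iic).symm

theorem measurable_noncentralChiSq_apply (n : ℕ) (S : Set ℝ) (hS : MeasurableSet S) :
    Measurable fun l => noncentralChiSq n l S := by
  simp only [noncentralChiSq, Measure.sum_apply _ hS, Measure.smul_apply, smul_eq_mul]
  refine Measurable.tsum fun j => ?_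
  unfold poissonWeight
  fun_prop

/-! ### Separating the shared variables from those of the ports. -/

/-- The family of all variables, assembled from the shared ones and those of each port. -/
def assembleVars {N K : ℕ} (p : (Fin N ⊕ Fin N → ℝ) × (Fin K → Fin N ⊕ Fin N → ℝ)) :
    (Fin N × Fin (K + 1)) ⊕ (Fin N × Fin (K + 1)) → ℝ
  | Sum.inl s => Fin.cases (p.1 (Sum.inl s.1)) (fun k => p.2 k (Sum.inl s.1)) s.2
  | Sum.inr s => Fin.cases (p.1 (Sum.inr s.1)) (fun k => p.2 k (Sum.inr s.1)) s.2

theorem measurable_assembleVars {N K : ℕ} : Measurable (assembleVars (N := N) (K := K)) := by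
  refine measurable_pi_lambda _ fun s => ?_
  rcases s with ⟨m, k⟩ | ⟨m, k⟩ <;> refine Fin.cases ?_ (fun k => ?_) k <;>
    simp only [assembleVars, Fin.cases_zero, Fin.cases_succ] <;> fun_prop

/-- Product measures are determined on boxes, and the preimage of a box is again a product of boxes.
-/
theorem map_assembleVars {N K : ℕ} (γ : Measure ℝ) [IsProbabilityMeasure γ] :
    ((Measure.pi fun _ : Fin N ⊕ Fin N => γ).prod
      (Measure.pi fun _ : Fin K => Measure.pi fun _ : Fin N ⊕ Fin N => γ)).map assembleVars
      = Measure.pi fun _ : (Fin N × Fin (K + 1)) ⊕ (Fin N × Fin (K + 1)) => γ := by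
  refine (Measure.pi_eq fun s hs => ?_).symm
  rw [Measure.map_apply measurable_assembleVars (MeasurableSet.univ_pi hs)]
  have hpre : assembleVars ⁻¹' pi univ s =
      (pi univ fun i : Fin N ⊕ Fin N =>
        Sum.elim (fun m => s (Sum.inl (m, 0))) (fun m => s (Sum.inr (m, 0))) i) ×ˢ
      (pi univ fun k : Fin K => pi univ fun i : Fin N ⊕ Fin N =>
        Sum.elim (fun m => s (Sum.inl (m, k.succ))) (fun m => s (Sum.inr (m, k.succ))) i) := by
    ext p
    simp only [mem_preimage, mem_pi, mem_univ, forall_true_left, mem_prod, Sum.forall,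
      Prod.forall, Fin.forall_fin_succ, assembleVars, Fin.cases_zero, Fin.cases_succ,
      Sum.elim_inl, Sum.elim_inr, forall_and]
    rw [forall_comm (α := Fin N) (β := Fin K), forall_comm (α := Fin N) (β := Fin K)]
    tauto
  rw [hpre, Measure.prod_prod]
  simp only [Measure.pi_pi, Fintype.prod_sum_type, Fintype.prod_prod_type, Fin.prod_univ_succ,
    Sum.elim_inl, Sum.elim_inr, Finset.prod_mul_distrib]
  rw [Finset.prod_comm (s := (Finset.univ : Finset (Fin K))),
    Finset.prod_comm (s := (Finset.univ : Finset (Fin K)))]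
  ring

/-- The joint law of the noncentral chi-square port powers that share a central part. -/
theorem prod_pi_gaussianReal_forall_lt (n K : ℕ) {ι : Type*} [Fintype ι]
    (hι : Fintype.card ι = 2 * (n + 1)) (c T : ℝ) :
    ((Measure.pi fun _ : ι => gaussianReal 0 1).prod
      (Measure.pi fun _ : Fin K => Measure.pi fun _ : ι => gaussianReal 0 1))
      {p | ∀ k, ∑ i, (p.2 k i + c * p.1 i) ^ 2 < T}
      = ∫⁻ r in Ioi 0, ENNReal.ofReal (chiSqDensity n r) *
        noncentralChiSq n (c ^ 2 * r) (Iio T) ^ K := by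
  have hS : MeasurableSet {p : (ι → ℝ) × (Fin K → ι → ℝ) |
      ∀ k, ∑ i, (p.2 k i + c * p.1 i) ^ 2 < T} := by
    rw [ofPred_forall]
    exact MeasurableSet.iInter fun k => measurableSet_lt (by fun_prop) (by fun_prop)
  have hF : Measurable fun r : ℝ => noncentralChiSq n (c ^ 2 * r) (Iio T) ^ K :=
    ((measurable_noncentralChiSq_apply n _ measurableSet_Iio).comp
      (measurable_id.const_mul _)).pow_const _
  -- For fixed `u` the event is a box over the ports. The `+ 0` lets the shifted-Gaussian lemma,
  -- with zero shift, give the law of `|u|²` as well.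
  have hslice : ∀ u : ι → ℝ, (Measure.pi fun _ : Fin K => Measure.pi fun _ : ι =>
      gaussianReal 0 1) (Prod.mk u ⁻¹' {p | ∀ k, ∑ i, (p.2 k i + c * p.1 i) ^ 2 < T})
      = noncentralChiSq n (c ^ 2 * ∑ i, (u i + 0) ^ 2) (Iio T) ^ K := by
    intro u
    have hset : Prod.mk u ⁻¹' {p : (ι → ℝ) × (Fin K → ι → ℝ) |
        ∀ k, ∑ i, (p.2 k i + c * p.1 i) ^ 2 < T} = pi univ fun _ : Fin K =>
        (fun z : ι → ℝ => ∑ i, (z i + c * u i) ^ 2) ⁻¹' Iio T := by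
      ext v; simp
    have hc : c ^ 2 * ∑ i, (u i + 0) ^ 2 = ∑ i, (c * u i) ^ 2 := by
      simp only [Finset.mul_sum, add_zero, mul_pow]
    rw [hset, Measure.pi_pi, Finset.prod_const, Finset.card_univ, Fintype.card_fin, hc,
      ← map_sum_sq_add_pi_gaussianReal n hι (fun i => c * u i),
      Measure.map_apply (by fun_prop) measurableSet_Iio]
  have hmap := map_sum_sq_add_pi_gaussianReal n hι (fun _ => 0)
  have hres : (noncentralChiSq n 0).restrict (Ioi 0) = noncentralChiSq n 0 := by
    refine Measure.restrict_eq_self_of_ae_mem ?_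
    have h0 : noncentralChiSq n 0 (Iic 0) = 0 := by
      rw [← measure_congr (Iio_ae_eq_Iic (a := (0 : ℝ)))]
      exact noncentralChiSq_Iio_zero n 0
    rw [ae_iff]
    convert h0 using 2
    ext x; simp
  rw [Measure.prod_apply hS]
  simp only [hslice]
  rw [← lintegral_map (μ := Measure.pi fun _ : ι => gaussianReal 0 1)
      (g := fun u : ι → ℝ => ∑ i, (u i + 0) ^ 2) hF (by fun_prop), hmap]
  simp only [ne_eq, OfNat.ofNat_ne_zero, not_false_eq_true, zero_pow, Finset.sum_const_zero]
  rw [← hres, restrict_noncentralChiSq n le_rfl measurableSet_Ioi Ioi_subset_Ici_self]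
  simp only [noncentralDensity_zero]
  have hd : Measurable fun r : ℝ => ENNReal.ofReal (chiSqDensity n r) := by
    unfold chiSqDensity; fun_prop
  rw [lintegral_withDensity_eq_lintegral_mul _ hd hF]
  rfl

/-! ### Transfer to the channel. -/

theorem IsChannel.map_allVars {Ω : Type*} [MeasurableSpace Ω] {Pr : Measure Ω}
    [IsProbabilityMeasure Pr] {N K : ℕ} {x y : Fin N → Fin (K + 1) → Ω → ℝ}
    (h : IsChannel Pr x y) :
    Pr.map (fun ω s => allVars x y s ω) = Measure.pi fun _ => gaussianReal 0 1 := by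
  rw [(iIndepFun_iff_map_fun_eq_pi_map fun s => (h.law s).aemeasurable).1 h.indep]
  simp only [(h.law _).map_eq]

theorem IsChannel.measure_forall_normPower_lt {Ω : Type*} [MeasurableSpace Ω] {Pr : Measure Ω}
    [IsProbabilityMeasure Pr] {n K : ℕ} {x y : Fin (n + 1) → Fin (K + 1) → Ω → ℝ}
    (h : IsChannel Pr x y) (μ T : ℝ) :
    Pr {ω | ∀ k, normPower μ x y k ω < T}
      = ∫⁻ r in Ioi 0, ENNReal.ofReal (chiSqDensity n r) *
        noncentralChiSq n ((μ / √(1 - μ ^ 2)) ^ 2 * r) (Iio T) ^ K := by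
  set c := μ / √(1 - μ ^ 2) with hc
  let S : Set ((Fin (n + 1) × Fin (K + 1)) ⊕ (Fin (n + 1) × Fin (K + 1)) → ℝ) :=
    {z | ∀ k : Fin K, ∑ m, ((z (Sum.inl (m, k.succ)) + c * z (Sum.inl (m, 0))) ^ 2
      + (z (Sum.inr (m, k.succ)) + c * z (Sum.inr (m, 0))) ^ 2) < T}
  have hS : MeasurableSet S := by
    simp only [S]
    rw [ofPred_forall]
    exact MeasurableSet.iInter fun k => measurableSet_lt (by fun_prop) (by fun_prop)
  have hX : AEMeasurable (fun ω s => allVars x y s ω) Pr :=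
    aemeasurable_pi_lambda _ fun s => (h.law s).aemeasurable
  rw [← prod_pi_gaussianReal_forall_lt n K (ι := Fin (n + 1) ⊕ Fin (n + 1))
    (by simp; ring) c T]
  calc _ = Pr.map (fun ω s => allVars x y s ω) S := by
        rw [Measure.map_apply_of_aemeasurable hX hS]; rfl
    _ = _ := by
        rw [h.map_allVars, ← map_assembleVars, Measure.map_apply measurable_assembleVars hS]
        congr 1
        ext p
        simp [S, assembleVars, Fintype.sum_sum_type, Finset.sum_add_distrib]

theorem harvestedPower_eq {Ω : Type*} {N K : ℕ} {μ : ℝ} (hμ : |μ| < 1) (P : ℝ)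
    (x y : Fin N → Fin (K + 1) → Ω → ℝ) (k : Fin K) (ω : Ω) :
    harvestedPower μ (fun _ => P) x y k ω = (1 - μ ^ 2) * P * normPower μ x y k ω := by
  have h1 : 0 < 1 - μ ^ 2 := by have := (sq_lt_one_iff_abs_lt_one μ).2 hμ; linarith
  have hs : √(1 - μ ^ 2) ≠ 0 := (Real.sqrt_pos.2 h1).ne'
  rw [harvestedPower, normPower, Finset.mul_sum]
  refine Finset.sum_congr rfl fun m _ => ?_
  rw [gain, Complex.sq_norm, mul_comm Complex.I, Complex.normSq_add_mul_I]
  nth_rw 3 [← Real.sq_sqrt h1.le]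
  field_simp

end FAMA

end

theorem theorem1 {Ω : Type*} [MeasurableSpace Ω] (Pr : Measure Ω) [IsProbabilityMeasure Pr]
    (N K : ℕ) [NeZero N] [NeZero K] (μ P Qth : ℝ) (hμ : |μ| < 1) (hP : 0 < P) (hQ : 0 ≤ Qth)
    (x y : Fin N → Fin (K + 1) → Ω → ℝ) (hxy : FAMA.IsChannel Pr x y)
    (kstar : Ω → Fin K) (hk : FAMA.IsBestPort μ (fun _ => P) x y kstar) :
    FAMA.wetOutage Pr μ (fun _ => P) x y kstar Qth
        = Pr.real {ω | Finset.univ.sup' Finset.univ_nonempty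
            (fun k : Fin K => (1 - μ ^ 2) * P * FAMA.normPower μ x y k ω) < Qth}
      ∧ IntegrableOn (fun r : ℝ =>
          r ^ (N - 1) * Real.exp (-r / 2) / (2 ^ N * Real.Gamma N)
            * (1 - FAMA.marcumQ N (√(μ ^ 2 * r / (1 - μ ^ 2)))
                (√(Qth / (P * (1 - μ ^ 2))))) ^ K) (Ioi 0)
      ∧ FAMA.wetOutage Pr μ (fun _ => P) x y kstar Qth
        = ∫ r in Ioi (0 : ℝ),
          r ^ (N - 1) * Real.exp (-r / 2) / (2 ^ N * Real.Gamma N)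
            * (1 - FAMA.marcumQ N (√(μ ^ 2 * r / (1 - μ ^ 2)))
                (√(Qth / (P * (1 - μ ^ 2))))) ^ K := by
  have h1 : 0 < 1 - μ ^ 2 := by have := (sq_lt_one_iff_abs_lt_one μ).2 hμ; linarith
  obtain ⟨n, rfl⟩ := Nat.exists_eq_succ_of_ne_zero (NeZero.ne N)
  set T := Qth / (P * (1 - μ ^ 2)) with hTdef
  have hT : 0 ≤ T := by positivity
  -- This makes the event independent of how ties are broken, and no measurability of `kstar` is
  -- needed.
  have hbest : ∀ ω, FAMA.harvestedPower μ (fun _ => P) x y (kstar ω) ω < Qth ↔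
      ∀ k, FAMA.harvestedPower μ (fun _ => P) x y k ω < Qth :=
    fun ω => ⟨fun h k => (hk ω k).trans_lt h, fun h => h _⟩
  have hlt : ∀ ω k, FAMA.harvestedPower μ (fun _ => P) x y k ω < Qth ↔
      FAMA.normPower μ x y k ω < T := by
    intro ω k
    rw [FAMA.harvestedPower_eq hμ, hTdef, lt_div_iff₀ (by positivity)]
    ring_nf
  have hout : Pr {ω | FAMA.harvestedPower μ (fun _ => P) x y (kstar ω) ω < Qth}
      = ∫⁻ r in Ioi 0, ENNReal.ofReal (FAMA.chiSqDensity n r) *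
        FAMA.noncentralChiSq n ((μ / √(1 - μ ^ 2)) ^ 2 * r) (Iio T) ^ K := by
    simp only [hbest, hlt]
    exact hxy.measure_forall_normPower_lt μ T
  have hG : ∀ r ∈ Ioi (0 : ℝ), r ^ (n.succ - 1) * Real.exp (-r / 2) /
      (2 ^ n.succ * Real.Gamma n.succ) *
      (1 - FAMA.marcumQ n.succ (√(μ ^ 2 * r / (1 - μ ^ 2))) √T) ^ K
      = (ENNReal.ofReal (FAMA.chiSqDensity n r) *
        FAMA.noncentralChiSq n ((μ / √(1 - μ ^ 2)) ^ 2 * r) (Iio T) ^ K).toReal := by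
    intro r hr
    have hr' : 0 < r := hr
    rw [FAMA.one_sub_marcumQ n (by positivity) hT, ENNReal.toReal_mul, ENNReal.toReal_pow,
      ENNReal.toReal_ofReal (FAMA.chiSqDensity_nonneg n hr'.le), FAMA.chiSqDensity,
      Nat.succ_eq_add_one, Nat.cast_add_one, Real.Gamma_nat_eq_factorial, div_pow,
      Real.sq_sqrt h1.le, mul_div_right_comm (μ ^ 2) r]
    rfl
  have hmeas : Measurable fun r : ℝ => ENNReal.ofReal (FAMA.chiSqDensity n r) *
        FAMA.noncentralChiSq n ((μ / √(1 - μ ^ 2)) ^ 2 * r) (Iio T) ^ K := by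
    refine Measurable.mul (by unfold FAMA.chiSqDensity; fun_prop) ?_
    exact ((FAMA.measurable_noncentralChiSq_apply n _ measurableSet_Iio).comp
      (measurable_id.const_mul _)).pow_const _
  -- The integral is a probability, hence finite; this yields integrability.
  have hfin : (∫⁻ r in Ioi 0, ENNReal.ofReal (FAMA.chiSqDensity n r) *
        FAMA.noncentralChiSq n ((μ / √(1 - μ ^ 2)) ^ 2 * r) (Iio T) ^ K) ≠ ⊤ :=
    hout ▸ measure_ne_top _ _
  refine ⟨?_, ?_, ?_⟩
  · rw [FAMA.wetOutage]
    congr 1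
    ext ω
    simp only [mem_ofPred_eq, Finset.sup'_lt_iff, Finset.mem_univ, forall_true_left]
    rw [hbest]
    simp only [FAMA.harvestedPower_eq hμ]
  · exact (integrableOn_congr_fun hG measurableSet_Ioi).2
      (integrable_toReal_of_lintegral_ne_top hmeas.aemeasurable hfin)
  · rw [setIntegral_congr_fun measurableSet_Ioi hG, integral_toReal hmeas.aemeasurable
      (ae_lt_top hmeas hfin), ← hout]
    rfl
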